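/- **Setting.** A graph $\Gamma$ has vertices $\Gamma^0$, edges $\Gamma^1$, terminus and origin maps $t,o$, and an edge reversal with $\bar e\neq e$, $\bar{\bar e}=e$, $t(\bar e)=o(e)$. A path $e_1\cdots e_n$ satisfies $o(e_i)=t(e_{i+1})$; it is without backtracking if $e_{i+1}\ne\bar e_i$ for all $i$. In a groupoid, $r$ and $s$ denote range and source, and $gh$ is defined iff $s(g)=r(h)$. Let $\mathcal G(\Gamma)$ be a graph of groupoids: $\Gamma$ is connected, each vertex $v$ carries a (discrete) groupoid $\mathcal G_v$, each edge $e$ a groupoid $\mathcal G_e=\mathcal G_{\bar e}$ and an injective homomorphism $\alpha_e\colon\mathcal G_e\to\mathcal G_{t(e)}$ whose image $\mathcal H_e$ is wide (contains all units). Put $\phi_e=\alpha_e\circ\alpha_{\bar e}^{-1}\colon\mathcal H_{\bar e}\to\mathcal H_e$. It restricts to a bijection $\mathcal G_{o(e)}^{(0)}\to\mathcal G_{t(e)}^{(0)}$. Let $T\subseteq\Gamma$ be a maximal subtree with root $r_0$, let $X=\mathcal G_{r_0}^{(0)}$, and let $\tau\colon\bigsqcup_v\mathcal G_v^{(0)}\to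 X$ send a unit $y\in\mathcal G_v^{(0)}$ to the unique $x\in X$ that is carried to $y$ by the composite $\phi_{f_1}\circ\cdots\circ\phi_{f_k}$ along the path $f_1\cdots f_k$ without backtracking in $T$ from $v$ to $r_0$. The *free groupoid* $\mathcal F(\mathcal G(\Gamma))$ is the groupoid with unit space $X$ generated by the elements $g\in\mathcal G_v$ ($v\in\Gamma^0$), with range $\tau(r(g))$ and source $\tau(s(g))$, and the elements $(\phi_e(x),x)$ ($e\in\Gamma^1$, $x\in\mathcal G_{o(e)}^{(0)}$; one for each pair $e,x$), with range $\tau(\phi_e(x))$, source $\tau(x)$ and inverse $(x,\phi_e(x))$ (the generator belonging to $\bar e$), subject to the relations of the vertex groupoids and $$(\alpha_e(r(g)),\alpha_{\bar e}(r(g)))\cdot\alpha_{\bar e}(g)\cdot(\alpha_{\bar e}(s(g)),\alpha_e(s(g)))=\alpha_e(g)\qquad(e\in\Gamma^1,\ g\in\mathcal G_e).$$ The *fundamental groupoid* $\pi_1(\mathcal G(\Gamma))$ is obtained by imposing in addition $(\phi_e(x),x)=\mathrm{id}_{\tau(x)}$ for all $e\in T^1$, $x\in\mathcal G_{o(e)}^{(0)}$.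 A *graph of groupoids word* is a sequence $p=g_1e_1g_2\cdots g_ne_ng_{n+1}$, $n\ge0$, with $o(e_i)=t(e_{i+1})$, $g_i\in\mathcal G_{t(e_i)}$ for $i\le n$, $g_{n+1}\in\mathcal G_{o(e_n)}$ and $\phi_{\bar e_i}(s(g_i))=r(g_{i+1})$; for $n=0$ it is a single element $g_1$ of some vertex groupoid. It represents the product of its letters, with $e_i$ read as the generator $(\phi_{e_i}(x),x)$, $x=r(g_{i+1})$. It is *reduced in the sense of Serre* if either $n=0$ and $g_1$ is not a unit, or $n>0$ and $g_{i+1}\notin\mathcal H_{\bar e_i}$ whenever $e_{i+1}=\bar e_i$. **Lemma (Britton's Lemma).** Let $p=g_1e_1g_2\cdots g_ne_ng_{n+1}$ be a graph of groupoids word which is reduced in the sense of Serre. Then: 1. $p$ does not represent a unit in the free groupoid $\mathcal F(\mathcal G(\Gamma))$. 2. If $p$ is closed, that is, $n=0$ or $t(e_1)=o(e_n)$, then $p$ does not represent a unit in the fundamental groupoid $\pi_1(\mathcal G(\Gamma))$. 3. More generally, if $p$ represents a unit in $\pi_1(\mathcal G(\Gamma))$, then $n\geq 1$ and $e_1\cdots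 e_n$ is a path without backtracking all of whose edges lie in $T$. -/

import Mathlib

open CategoryTheory

set_option linter.checkUnivs false

universe uV uE uG vG uH vH

/-- A combinatorial graph in the sense of Serre: every edge `e` has a terminus `t e`, an origin
`o e` and a reversed edge `bar e ≠ e`. -/
structure SerreGraph (V : Type uV) (E : Type uE) where
  t : E → V
  o : E → V
  bar : E → E
  bar_ne : ∀ e, bar e ≠ e
  bar_bar : ∀ e, bar (bar e) = e
  t_bar : ∀ e, t (bar e) = o e

namespace SerreGraph

variable {V : Type uV} {E : Type uE} (Γ : SerreGraph V E)

theorem o_bar (e : E) : Γ.o (Γ.bar e) = Γ.t e := by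
  rw [← Γ.t_bar, Γ.bar_bar]

/-- `Γ.IsPath v w [e₁, …, eₙ]`: the sequence `e₁ ⋯ eₙ` is a path from `v` to `w`, that is
`v = t e₁`, `o eᵢ = t eᵢ₊₁` and `o eₙ = w`; the empty sequence is the path of length `0` at
`v = w`. -/
def IsPath : V → V → List E → Prop
  | v, w, [] => v = w
  | v, w, e :: l => Γ.t e = v ∧ IsPath (Γ.o e) w l

/-- No two consecutive edges of the sequence are mutually inverse. -/
def IsReduced (l : List E) : Prop :=
  l.IsChain (fun e e' => e' ≠ Γ.bar e)

/-- Any two vertices are joined by a path without backtracking. -/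
def Connected : Prop :=
  ∀ v w, ∃ l, Γ.IsPath v w l ∧ Γ.IsReduced l

/-- The unoriented edges `{e, bar e}`. -/
def UEdge : Type uE :=
  Quot (fun e e' : E => e' = Γ.bar e)

/-- The unoriented edge `{e, bar e}`. -/
def uedge (e : E) : Γ.UEdge :=
  Quot.mk _ e

theorem uedge_bar (e : E) : Γ.uedge (Γ.bar e) = Γ.uedge e :=
  (Quot.sound (r := fun e e' : E => e' = Γ.bar e) rfl).symm

/-- A subgraph: a non-empty set of vertices and a set of edges which is closed under reversal,
with all endpoints in the set of vertices. -/
@[ext]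
structure Subgraph where
  verts : Set V
  edges : Set E
  nonempty : verts.Nonempty
  bar_mem : ∀ e ∈ edges, Γ.bar e ∈ edges
  t_mem : ∀ e ∈ edges, Γ.t e ∈ verts
  o_mem : ∀ e ∈ edges, Γ.o e ∈ verts

instance : LE Γ.Subgraph where
  le S T := S.verts ⊆ T.verts ∧ S.edges ⊆ T.edges

variable {Γ}

/-- A subgraph is a tree if any two of its vertices are joined by exactly one path without
backtracking whose edges lie in the subgraph. -/
def Subgraph.IsTree (T : Γ.Subgraph) : Prop :=
  ∀ v ∈ T.verts, ∀ w ∈ T.verts,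
    ∃! l : List E, Γ.IsPath v w l ∧ Γ.IsReduced l ∧ ∀ e ∈ l, e ∈ T.edges

variable (Γ)

/-- A maximal subtree of `Γ` with a chosen root. -/
structure RootedMaximalSubtree extends Γ.Subgraph where
  maximal : Maximal Subgraph.IsTree toSubgraph
  root : V
  root_mem : root ∈ verts

variable {Γ}

theorem exists_leaving_edge (S : Set V) : ∀ (l : List E) (v w : V),
    Γ.IsPath v w l → v ∈ S → w ∉ S → ∃ e, Γ.t e ∈ S ∧ Γ.o e ∉ S
  | [], v, w, h, hv, hw => by
    have h' : v = w := h
    exact absurd (h' ▸ hv) hw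
  | e :: l, v, w, h, hv, hw => by
    obtain ⟨h1, h2⟩ := h
    by_cases ho : Γ.o e ∈ S
    · exact exists_leaving_edge S l _ w h2 ho hw
    · exact ⟨e, h1 ▸ hv, ho⟩

theorem isPath_append_singleton : ∀ (l : List E) (v w : V) (e : E),
    Γ.IsPath v w (l ++ [e]) ↔ Γ.IsPath v (Γ.t e) l ∧ Γ.o e = w
  | [], v, w, e => by simp [IsPath, eq_comm]
  | f :: l, v, w, e => by
    simp [IsPath, isPath_append_singleton l, and_assoc]

/-- The subgraph obtained from `T` by attaching an edge that leaves `T`. -/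
def Subgraph.attach (T : Γ.Subgraph) (e : E) (ht : Γ.t e ∈ T.verts) : Γ.Subgraph where
  verts := insert (Γ.o e) T.verts
  edges := insert e (insert (Γ.bar e) T.edges)
  nonempty := ⟨_, Set.mem_insert _ _⟩
  bar_mem := by
    rintro f (rfl | rfl | hf)
    · simp
    · simp [Γ.bar_bar]
    · exact Or.inr (Or.inr (T.bar_mem f hf))
  t_mem := by
    rintro f (rfl | rfl | hf)
    · exact Or.inr ht
    · exact Or.inl (Γ.t_bar _)
    · exact Or.inr (T.t_mem f hf)
  o_mem := by
    rintro f (rfl | rfl | hf)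
    · exact Or.inl rfl
    · exact Or.inr (by rwa [Γ.o_bar])
    · exact Or.inr (T.o_mem f hf)

theorem Subgraph.attach_path (T : Γ.Subgraph) (e : E) (ht : Γ.t e ∈ T.verts)
    (ho : Γ.o e ∉ T.verts) : ∀ (l : List E) (a b : V), a ∈ T.verts → Γ.IsPath a b l →
    Γ.IsReduced l → (∀ f ∈ l, f ∈ (T.attach e ht).edges) →
    (b ∈ T.verts ∧ ∀ f ∈ l, f ∈ T.edges) ∨
      (b = Γ.o e ∧ ∃ l₀, l = l₀ ++ [e] ∧ Γ.IsPath a (Γ.t e) l₀ ∧ Γ.IsReduced l₀ ∧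
        ∀ f ∈ l₀, f ∈ T.edges)
  | [], a, b, ha, hp, _, _ => by
    have h' : a = b := hp
    exact Or.inl ⟨h' ▸ ha, by simp⟩
  | f :: l, a, b, ha, hp, hr, hl => by
    obtain ⟨h1, h2⟩ := hp
    have hr' : Γ.IsReduced l := hr.tail
    have hl' : ∀ g ∈ l, g ∈ (T.attach e ht).edges := fun g hg => hl g (List.mem_cons_of_mem _ hg)
    rcases hl f List.mem_cons_self with rfl | rfl | hf
    · right
      cases l with
      | nil => exact ⟨h2.symm, [], rfl, h1.symm, List.IsChain.nil, by simp⟩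
      | cons g l =>
        exfalso
        have hg : g ≠ Γ.bar f := (List.isChain_cons_cons.1 hr).1
        have htg : Γ.t g = Γ.o f := h2.1
        rcases hl' g List.mem_cons_self with rfl | rfl | hg'
        · exact ho (htg ▸ ht)
        · exact hg rfl
        · exact ho (htg ▸ T.t_mem g hg')
    · exact absurd (by rw [← Γ.t_bar, h1]; exact ha) ho
    · rcases T.attach_path e ht ho l _ b (T.o_mem f hf) h2 hr' hl' with h | h
      · exact Or.inl ⟨h.1, by
          intro g hg
          rcases List.mem_cons.1 hg with rfl | hg
          · exact hf
          · exact h.2 g hg⟩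
      · obtain ⟨hb, l₀, rfl, hp₀, hr₀, hl₀⟩ := h
        refine Or.inr ⟨hb, f :: l₀, rfl, ⟨h1, hp₀⟩, ?_, ?_⟩
        · exact List.IsChain.left_of_append (l₂ := [e]) hr
        · intro g hg
          rcases List.mem_cons.1 hg with rfl | hg
          · exact hf
          · exact hl₀ g hg

theorem Subgraph.attach_isTree (T : Γ.Subgraph) (hT : T.IsTree) (e : E) (ht : Γ.t e ∈ T.verts)
    (ho : Γ.o e ∉ T.verts) : (T.attach e ht).IsTree := by
  have heT : e ∉ T.edges := fun h => ho (T.o_mem e h)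
  have heT' : Γ.bar e ∉ T.edges := fun h => heT (by simpa [Γ.bar_bar] using T.bar_mem _ h)
  have hsub : ∀ f ∈ T.edges, f ∈ (T.attach e ht).edges := fun f hf => Or.inr (Or.inr hf)
  have he1 : e ∈ (T.attach e ht).edges := Or.inl rfl
  have he2 : Γ.bar e ∈ (T.attach e ht).edges := Or.inr (Or.inl rfl)
  have hnil : ∀ l, Γ.IsPath (Γ.t e) (Γ.t e) l → Γ.IsReduced l → (∀ f ∈ l, f ∈ T.edges) →
      l = [] := fun l h1 h2 h3 =>
    (hT _ ht _ ht).unique ⟨h1, h2, h3⟩ ⟨rfl, List.IsChain.nil, by simp⟩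
  -- a path that starts at the new vertex is trivial or starts with `bar e`
  have hstart : ∀ b f l, Γ.IsPath (Γ.o e) b (f :: l) →
      (∀ g ∈ f :: l, g ∈ (T.attach e ht).edges) → f = Γ.bar e := by
    intro b f l hp hl
    rcases hl f List.mem_cons_self with rfl | rfl | hf
    · exact absurd (by rw [← hp.1]; exact ht) ho
    · rfl
    · exact absurd (by rw [← hp.1]; exact T.t_mem f hf) ho
  rintro a (rfl | ha) b (rfl | hb)
  · refine ⟨[], ⟨rfl, List.IsChain.nil, by simp⟩, ?_⟩
    rintro l ⟨hp, hr, hl⟩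
    cases l with
    | nil => rfl
    | cons f l =>
      exfalso
      obtain rfl := hstart _ f l hp hl
      have hp' : Γ.IsPath (Γ.t e) (Γ.o e) l := by
        have := hp.2
        rwa [Γ.o_bar] at this
      rcases T.attach_path e ht ho l _ _ ht hp' hr.tail
        (fun g hg => hl g (List.mem_cons_of_mem _ hg)) with h | ⟨-, l₀, rfl, hp₀, hr₀, hl₀⟩
      · exact ho h.1
      · obtain rfl := hnil l₀ hp₀ hr₀ hl₀
        have := (List.isChain_cons_cons.1 hr).1
        exact this (Γ.bar_bar e).symm
  · obtain ⟨l, ⟨hp, hr, hl⟩, hu⟩ := hT _ ht _ hb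
    refine ⟨Γ.bar e :: l, ⟨⟨Γ.t_bar e, by rwa [Γ.o_bar]⟩, ?_, ?_⟩, ?_⟩
    · refine List.isChain_cons.2 ⟨?_, hr⟩
      intro f hf
      rw [Γ.bar_bar]
      rintro rfl
      exact heT (hl _ (List.mem_of_mem_head? hf))
    · intro f hf
      rcases List.mem_cons.1 hf with rfl | hf
      · exact he2
      · exact hsub f (hl f hf)
    · rintro l' ⟨hp', hr', hl'⟩
      cases l' with
      | nil => exact absurd ((show Γ.o e = b from hp') ▸ hb) ho
      | cons f l' =>
        obtain rfl := hstart _ f l' hp' hl'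
        have hp'' : Γ.IsPath (Γ.t e) b l' := by
          have := hp'.2
          rwa [Γ.o_bar] at this
        rcases T.attach_path e ht ho l' _ _ ht hp'' hr'.tail
          (fun g hg => hl' g (List.mem_cons_of_mem _ hg)) with h | ⟨rfl, -⟩
        · rw [hu l' ⟨hp'', hr'.tail, h.2⟩]
        · exact absurd hb ho
  · obtain ⟨l, ⟨hp, hr, hl⟩, hu⟩ := hT _ ha _ ht
    refine ⟨l ++ [e], ⟨(isPath_append_singleton l _ _ e).2 ⟨hp, rfl⟩, ?_, ?_⟩, ?_⟩
    · refine List.isChain_append.2 ⟨hr, List.isChain_singleton _, ?_⟩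
      intro f hf g hg
      simp only [List.head?_cons, Option.mem_def, Option.some.injEq] at hg
      subst hg
      rintro rfl
      exact heT (T.bar_mem f (hl f (List.mem_of_mem_getLast? hf)))
    · intro f hf
      rcases List.mem_append.1 hf with hf | hf
      · exact hsub f (hl f hf)
      · rw [List.mem_singleton.1 hf]
        exact he1
    · rintro l' ⟨hp', hr', hl'⟩
      rcases T.attach_path e ht ho l' _ _ ha hp' hr' hl' with h | ⟨-, l₀, rfl, hp₀, hr₀, hl₀⟩
      · exact absurd h.1 ho
      · rw [hu l₀ ⟨hp₀, hr₀, hl₀⟩]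
  · obtain ⟨l, ⟨hp, hr, hl⟩, hu⟩ := hT _ ha _ hb
    refine ⟨l, ⟨hp, hr, fun f hf => hsub f (hl f hf)⟩, ?_⟩
    rintro l' ⟨hp', hr', hl'⟩
    rcases T.attach_path e ht ho l' _ _ ha hp' hr' hl' with h | ⟨rfl, -⟩
    · exact hu l' ⟨hp', hr', h.2⟩
    · exact absurd hb ho

/-- In a connected graph a maximal subtree contains all vertices. -/
theorem RootedMaximalSubtree.mem_verts (T : Γ.RootedMaximalSubtree) (hΓ : Γ.Connected) (v : V) :
    v ∈ T.verts := by
  by_contra hv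
  obtain ⟨l, hl, -⟩ := hΓ T.root v
  obtain ⟨e, ht, ho⟩ := exists_leaving_edge T.verts l _ _ hl T.root_mem hv
  have h := T.maximal.2 (T.attach_isTree T.maximal.1 e ht ho)
    ⟨Set.subset_insert _ _, fun f hf => Or.inr (Or.inr hf)⟩
  exact ho (h.1 (Set.mem_insert _ _))

end SerreGraph

/-- An arrow of a category is a unit if it is an identity morphism. -/
def IsUnitArrow {C : Type*} [Category C] {a b : C} (f : a ⟶ b) : Prop :=
  ∃ h : a = b, f = eqToHom h

/-- A graph of groupoids on the connected graph `Γ`.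

An arrow `g : x ⟶ y` has range `x` and source `y`, so that the product `g h`, defined if the
source of `g` is the range of `h`, is `g ≫ h`.

The edge groupoid is attached to the unoriented edge `u = {e, bar e}`, and `α u e _` is the
homomorphism `α_e` from it to the vertex groupoid at the terminus of `e`, for each of the two
orientations `e` of `u`. It is injective (on units and on arrows), and its image is a wide
subgroupoid, i.e. it contains all units. -/
structure GraphOfGroupoids {V : Type uV} {E : Type uE} (Γ : SerreGraph V E) where
  connected : Γ.Connected
  vert : V → Type uG
  vertGroupoid : ∀ v, Groupoid.{vG} (vert v)
  edge : Γ.UEdge → Type uH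
  edgeGroupoid : ∀ u, Groupoid.{vH} (edge u)
  α : ∀ (u : Γ.UEdge) (e : E), Γ.uedge e = u → (edge u ⥤ vert (Γ.t e))
  obj_injective : ∀ u e h, Function.Injective (α u e h).obj
  faithful : ∀ u e h, (α u e h).Faithful
  wide : ∀ u e h, Function.Surjective (α u e h).obj

namespace GraphOfGroupoids

attribute [instance] vertGroupoid edgeGroupoid

variable {V : Type uV} {E : Type uE} {Γ : SerreGraph V E}
  (𝒢 : GraphOfGroupoids.{uV, uE, uG, vG, uH, vH} Γ)

/-- The disjoint union `⊔_v 𝒢_v^{(0)}` of the unit spaces of the vertex groupoids. With Mathlib's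
category structure on a sigma type, its arrows are the elements of `⊔_v 𝒢_v`. -/
abbrev Y : Type (max uV uG) :=
  Σ v, 𝒢.vert v

/-- `α_e`, regarded as taking values in the disjoint union of all vertex groupoids. -/
abbrev incl (u : Γ.UEdge) (e : E) (h : Γ.uedge e = u) : 𝒢.edge u ⥤ 𝒢.Y :=
  𝒢.α u e h ⋙ Sigma.incl (C := 𝒢.vert) (Γ.t e)

/-- `𝒢.EdgeRel e y x`: `x` is a unit of `𝒢_{o(e)}` and `y = φ_e(x)`, where
`φ_e = α_e ∘ α_{bar e}⁻¹`. -/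
def EdgeRel (e : E) (y x : 𝒢.Y) : Prop :=
  ∃ (u : Γ.UEdge) (h : Γ.uedge e = u) (h' : Γ.uedge (Γ.bar e) = u) (z : 𝒢.edge u),
    y = (𝒢.incl u e h).obj z ∧ x = (𝒢.incl u (Γ.bar e) h').obj z

/-- `𝒢.InH e g`: the arrow `g` lies in `ℋ_e = α_e(𝒢_e) ⊆ 𝒢_{t(e)}`. -/
inductive InH (e : E) : ∀ {x y : 𝒢.Y}, (x ⟶ y) → Prop
  | mk (u : Γ.UEdge) (h : Γ.uedge e = u) {a b : 𝒢.edge u} (k : a ⟶ b) :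
      InH e ((𝒢.incl u e h).map k)

variable {𝒢}

theorem incl_congr (u : Γ.UEdge) {e f : E} (hef : e = f) (h : Γ.uedge e = u)
    (h' : Γ.uedge f = u) : 𝒢.incl u e h = 𝒢.incl u f h' := by
  subst hef
  rfl

/-- For `a ∈ 𝒢_e^{(0)}` one has `α_e(a) = φ_e(α_{bar e}(a))`. -/
theorem edgeRel_incl (u : Γ.UEdge) (e : E) (h : Γ.uedge e = u) (h' : Γ.uedge (Γ.bar e) = u)
    (a : 𝒢.edge u) : 𝒢.EdgeRel e ((𝒢.incl u e h).obj a) ((𝒢.incl u (Γ.bar e) h').obj a) :=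
  ⟨u, h, h', a, rfl, rfl⟩

/-- `φ_{bar e} = φ_e⁻¹`. -/
theorem EdgeRel.symm {e : E} {y x : 𝒢.Y} (h : 𝒢.EdgeRel e y x) : 𝒢.EdgeRel (Γ.bar e) x y := by
  obtain ⟨u, h, h', z, rfl, rfl⟩ := h
  have h'' : Γ.uedge (Γ.bar (Γ.bar e)) = u := by rwa [Γ.bar_bar]
  exact ⟨u, h', h'', z, rfl, by rw [incl_congr u (Γ.bar_bar e) h'' h]⟩

theorem EdgeRel.fst_left {e : E} {y x : 𝒢.Y} (h : 𝒢.EdgeRel e y x) : y.1 = Γ.t e := by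
  obtain ⟨u, h, h', z, rfl, rfl⟩ := h
  rfl

theorem EdgeRel.fst_right {e : E} {y x : 𝒢.Y} (h : 𝒢.EdgeRel e y x) : x.1 = Γ.o e := by
  rw [h.symm.fst_left, Γ.t_bar]

theorem EdgeRel.right_unique {e : E} {y x x' : 𝒢.Y} (h : 𝒢.EdgeRel e y x)
    (h₂ : 𝒢.EdgeRel e y x') : x = x' := by
  obtain ⟨u, hu, hu', z, rfl, rfl⟩ := h
  obtain ⟨u₂, rfl, hu₂', z₂, hz, rfl⟩ := h₂
  subst hu
  have := 𝒢.obj_injective _ e rfl (eq_of_heq (Sigma.mk.inj hz).2)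
  rw [this]

theorem exists_edgeRel {e : E} {y : 𝒢.Y} (hy : Γ.t e = y.1) : ∃ x, 𝒢.EdgeRel e y x := by
  obtain ⟨v, y⟩ := y
  subst hy
  obtain ⟨z, rfl⟩ := 𝒢.wide (Γ.uedge e) e rfl y
  exact ⟨_, edgeRel_incl _ e rfl (Γ.uedge_bar e) z⟩

variable (𝒢)

/-- `𝒢.Transport [e₁, …, eₙ] y x`: the composite `Φ_p = φ_{e₁} ∘ ⋯ ∘ φ_{eₙ}` along
`p = e₁ ⋯ eₙ` maps `x` to `y`. -/
def Transport : List E → 𝒢.Y → 𝒢.Y → Prop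
  | [], y, x => y = x
  | e :: l, y, x => ∃ y', 𝒢.EdgeRel e y y' ∧ Transport l y' x

/-- The relation `∼` on units defined by the tree `T`: there is a path `p` without backtracking
in `T` with `Φ_p(x) = y`. -/
def TreeRel (T : Γ.RootedMaximalSubtree) (y x : 𝒢.Y) : Prop :=
  ∃ l : List E, (Γ.IsPath y.1 x.1 l ∧ Γ.IsReduced l ∧ ∀ e ∈ l, e ∈ T.edges) ∧ 𝒢.Transport l y x

variable {𝒢}

theorem exists_transport : ∀ (l : List E) (y : 𝒢.Y) (w : V), Γ.IsPath y.1 w l →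
    ∃ x : 𝒢.vert w, 𝒢.Transport l y ⟨w, x⟩
  | [], y, w, h => by
    obtain ⟨v, y⟩ := y
    have h' : v = w := h
    subst h'
    exact ⟨y, rfl⟩
  | e :: l, y, w, h => by
    obtain ⟨y', hy'⟩ := exists_edgeRel (𝒢 := 𝒢) h.1
    obtain ⟨x, hx⟩ := exists_transport l y' w (by rw [hy'.fst_right]; exact h.2)
    exact ⟨x, y', hy', hx⟩

theorem Transport.right_unique : ∀ {l : List E} {y x x' : 𝒢.Y}, 𝒢.Transport l y x →
    𝒢.Transport l y x' → x = x'
  | [], _, _, _, h, h' => Eq.trans (Eq.symm h) h'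
  | _ :: _, _, _, _, ⟨_, h1, h2⟩, ⟨_, h1', h2'⟩ => by
    obtain rfl := h1.right_unique h1'
    exact Transport.right_unique h2 h2'

/-- The unit space of the root groupoid is a system of representatives for `∼`. -/
theorem existsUnique_treeRel (T : Γ.RootedMaximalSubtree) (y : 𝒢.Y) :
    ∃! x : 𝒢.vert T.root, 𝒢.TreeRel T y ⟨T.root, x⟩ := by
  obtain ⟨l, hl, hu⟩ := T.maximal.1 y.1 (T.mem_verts 𝒢.connected _) T.root T.root_mem
  obtain ⟨x, hx⟩ := exists_transport (𝒢 := 𝒢) l y _ hl.1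
  refine ⟨x, ⟨l, hl, hx⟩, ?_⟩
  rintro x' ⟨l', hl', hx'⟩
  obtain rfl := hu l' hl'
  exact eq_of_heq (Sigma.mk.inj (hx'.right_unique hx)).2

variable (𝒢)

/-- The set `X = 𝒢_r^{(0)}` of units of the groupoid at the root `r`. (A plain copy of the set,
carrying none of the arrows of `𝒢_r`.) -/
def UnitSpace (T : Γ.RootedMaximalSubtree) : Type uG :=
  𝒢.vert T.root

/-- The map `τ : ⊔_v 𝒢_v^{(0)} → X` assigning to each unit the element of `X` equivalent to it. -/
noncomputable def tau (T : Γ.RootedMaximalSubtree) (y : 𝒢.Y) : 𝒢.UnitSpace T :=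
  (existsUnique_treeRel T y).choose

variable {𝒢}

theorem tau_eq_iff (T : Γ.RootedMaximalSubtree) (y : 𝒢.Y) (x : 𝒢.vert T.root) :
    𝒢.tau T y = x ↔ 𝒢.TreeRel T y ⟨T.root, x⟩ := by
  constructor
  · rintro rfl
    exact (existsUnique_treeRel T y).choose_spec.1
  · intro h
    exact ((existsUnique_treeRel T y).choose_spec.2 x h).symm

/-- Along an edge `e` of the tree one has `τ(φ_e(x)) = τ(x)`. -/
theorem EdgeRel.tau_eq {T : Γ.RootedMaximalSubtree} {e : E} (he : e ∈ T.edges) {y x : 𝒢.Y}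
    (h : 𝒢.EdgeRel e y x) : 𝒢.tau T y = 𝒢.tau T x := by
  refine (tau_eq_iff T y _).2 ?_
  obtain ⟨l, ⟨hp, hr, hl⟩, htr⟩ := (tau_eq_iff T x _).1 rfl
  by_cases hc : ∃ l', l = Γ.bar e :: l'
  · obtain ⟨l', rfl⟩ := hc
    obtain ⟨y', hy', htr'⟩ := htr
    obtain rfl := hy'.right_unique h.symm
    refine ⟨l', ⟨?_, hr.tail, fun f hf => hl f (List.mem_cons_of_mem _ hf)⟩, htr'⟩
    rw [h.fst_left, ← Γ.o_bar]
    exact hp.2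
  · refine ⟨e :: l, ⟨⟨h.fst_left.symm, by rw [← h.fst_right]; exact hp⟩, ?_, ?_⟩, x, h, htr⟩
    · refine List.isChain_cons.2 ⟨?_, hr⟩
      rintro f hf rfl
      cases l with
      | nil => simp at hf
      | cons f l =>
        simp only [List.head?_cons, Option.mem_def, Option.some.injEq] at hf
        exact hc ⟨l, by rw [hf]⟩
    · intro f hf
      rcases List.mem_cons.1 hf with rfl | hf
      · exact he
      · exact hl f hf

variable (𝒢) (T : Γ.RootedMaximalSubtree)

/-- The generators: the elements `g` of the vertex groupoids, with range `τ(r(g))` and source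
`τ(s(g))`, and, for each edge `e` and each unit `x` of `𝒢_{o(e)}`, a generator `(φ_e(x), x)` with
range `τ(φ_e(x))` and source `τ(x)`. -/
inductive Gen : 𝒢.UnitSpace T → 𝒢.UnitSpace T → Type (max uV uE uG vG)
  | vert {x y : 𝒢.Y} (g : x ⟶ y) : Gen (𝒢.tau T x) (𝒢.tau T y)
  | edge (e : E) {y x : 𝒢.Y} (h : 𝒢.EdgeRel e y x) : Gen (𝒢.tau T y) (𝒢.tau T x)

instance : Quiver (𝒢.UnitSpace T) where
  Hom := 𝒢.Gen T

/-- The free groupoid on the generators, before imposing any relation. -/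
abbrev GenGroupoid : Type uG :=
  Quiver.FreeGroupoid (𝒢.UnitSpace T)

/-- The unit `τ(y)`, as an object of the free groupoid on the generators. -/
noncomputable abbrev unit (y : 𝒢.Y) : 𝒢.GenGroupoid T :=
  (Quiver.FreeGroupoid.of (𝒢.UnitSpace T)).obj (𝒢.tau T y)

/-- The generator `g ∈ 𝒢_v`. -/
noncomputable def vertGen {x y : 𝒢.Y} (g : x ⟶ y) : 𝒢.unit T x ⟶ 𝒢.unit T y :=
  (Quiver.FreeGroupoid.of (𝒢.UnitSpace T)).map (Gen.vert g)

/-- The generator `(y, x)` for the edge `e`, where `y = φ_e(x)`. -/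
noncomputable def edgeGen (e : E) {y x : 𝒢.Y} (h : 𝒢.EdgeRel e y x) :
    𝒢.unit T y ⟶ 𝒢.unit T x :=
  (Quiver.FreeGroupoid.of (𝒢.UnitSpace T)).map (Gen.edge e h)

/-- The relations of the free groupoid of the graph of groupoids: the relations in the vertex
groupoids, `(φ_e(x), x)⁻¹ = (x, φ_e(x))`, and `e α_{bar e}(k) bar e = α_e(k)` for `k ∈ 𝒢_e`. -/
inductive FreeRel : HomRel (𝒢.GenGroupoid T)
  | vert_id (x : 𝒢.Y) : FreeRel (𝒢.vertGen T (𝟙 x)) (𝟙 (𝒢.unit T x))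
  | vert_comp {x y z : 𝒢.Y} (g : x ⟶ y) (h : y ⟶ z) :
      FreeRel (𝒢.vertGen T (g ≫ h)) (𝒢.vertGen T g ≫ 𝒢.vertGen T h)
  | edge_inv (e : E) {y x : 𝒢.Y} (h : 𝒢.EdgeRel e y x) :
      FreeRel (𝒢.edgeGen T e h ≫ 𝒢.edgeGen T (Γ.bar e) h.symm) (𝟙 (𝒢.unit T y))
  | edge_conj (u : Γ.UEdge) (e : E) (h : Γ.uedge e = u) (h' : Γ.uedge (Γ.bar e) = u)
      {a b : 𝒢.edge u} (k : a ⟶ b) :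
      FreeRel
        (𝒢.edgeGen T e (edgeRel_incl u e h h' a) ≫ 𝒢.vertGen T ((𝒢.incl u (Γ.bar e) h').map k) ≫
          𝒢.edgeGen T (Γ.bar e) (edgeRel_incl u e h h' b).symm)
        (𝒢.vertGen T ((𝒢.incl u e h).map k))

/-- The relations of the fundamental groupoid: those of the free groupoid of the graph of
groupoids, and `(φ_e(x), x) = id_{τ(x)}` for the edges `e` of the tree. -/
inductive PiRel : HomRel (𝒢.GenGroupoid T)
  | free {a b : 𝒢.GenGroupoid T} {f g : a ⟶ b} (h : 𝒢.FreeRel T f g) : PiRel f g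
  | tree (e : E) (he : e ∈ T.edges) {y x : 𝒢.Y} (h : 𝒢.EdgeRel e y x) :
      PiRel (𝒢.edgeGen T e h)
        (eqToHom (congrArg (Quiver.FreeGroupoid.of (𝒢.UnitSpace T)).obj (h.tau_eq he)))

/-- The free groupoid `ℱ(𝒢(Γ))` of the graph of groupoids. -/
abbrev FreeGpd : Type uG :=
  CategoryTheory.Quotient (𝒢.FreeRel T)

/-- The fundamental groupoid `π₁(𝒢(Γ))` of the graph of groupoids. -/
abbrev Pi1 : Type uG :=
  CategoryTheory.Quotient (𝒢.PiRel T)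

/-- Graph of groupoids words `g₁ e₁ g₂ e₂ ⋯ gₙ eₙ gₙ₊₁` with `r(g₁) = x` and `s(gₙ₊₁) = z`. The
condition on consecutive letters is `s(gᵢ) = φ_{eᵢ}(r(gᵢ₊₁))`, i.e. `φ_{bar eᵢ}(s(gᵢ)) = r(gᵢ₊₁)`;
it contains `gᵢ ∈ 𝒢_{t(eᵢ)}` and `gᵢ₊₁ ∈ 𝒢_{o(eᵢ)}`, and hence `o(eᵢ) = t(eᵢ₊₁)`. -/
inductive Word : 𝒢.Y → 𝒢.Y → Type (max uV uE uG vG)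
  | nil {x z : 𝒢.Y} (g : x ⟶ z) : Word x z
  | cons {x y y' z : 𝒢.Y} (g : x ⟶ y) (e : E) (h : 𝒢.EdgeRel e y y') (p : Word y' z) : Word x z

namespace Word

variable {𝒢}

/-- The sequence `e₁, …, eₙ` of edges of a word. -/
def edges : ∀ {x z : 𝒢.Y}, 𝒢.Word x z → List E
  | _, _, nil _ => []
  | _, _, cons _ e _ p => e :: p.edges

/-- The first letter `g₁` of a word is not in `ℋ_f`. -/
def HeadNotInH (f : E) : ∀ {x z : 𝒢.Y}, 𝒢.Word x z → Prop
  | _, _, nil g => ¬ 𝒢.InH f g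
  | _, _, cons g _ _ _ => ¬ 𝒢.InH f g

/-- If `eᵢ₊₁ = bar eᵢ`, then `gᵢ₊₁ ∉ ℋ_{bar eᵢ}`. -/
def NoPinch : ∀ {x z : 𝒢.Y}, 𝒢.Word x z → Prop
  | _, _, nil _ => True
  | _, _, cons _ e _ p =>
      (p.edges.head? = some (Γ.bar e) → p.HeadNotInH (Γ.bar e)) ∧ p.NoPinch

/-- Reduced in the sense of Serre: a word of length `0` is not a unit, and in a word of positive
length `eᵢ₊₁ = bar eᵢ` implies `gᵢ₊₁ ∉ ℋ_{bar eᵢ}`. -/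
def SerreReduced : ∀ {x z : 𝒢.Y}, 𝒢.Word x z → Prop
  | _, _, nil g => ¬ IsUnitArrow g
  | _, _, cons g e h p => (cons g e h p).NoPinch

/-- The product of the letters of a word, where `eᵢ` is read as the generator
`(φ_{eᵢ}(r(gᵢ₊₁)), r(gᵢ₊₁))`. -/
noncomputable def eval : ∀ {x z : 𝒢.Y}, 𝒢.Word x z → (𝒢.unit T x ⟶ 𝒢.unit T z)
  | _, _, nil g => 𝒢.vertGen T g
  | _, _, cons g e h p => 𝒢.vertGen T g ≫ 𝒢.edgeGen T e h ≫ p.eval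

/-- The element of the free groupoid `ℱ(𝒢(Γ))` represented by a word. -/
noncomputable def toFree {x z : 𝒢.Y} (p : 𝒢.Word x z) :
    (CategoryTheory.Quotient.functor (𝒢.FreeRel T)).obj (𝒢.unit T x) ⟶
      (CategoryTheory.Quotient.functor (𝒢.FreeRel T)).obj (𝒢.unit T z) :=
  (CategoryTheory.Quotient.functor (𝒢.FreeRel T)).map (p.eval T)

/-- The element of the fundamental groupoid `π₁(𝒢(Γ))` represented by a word. -/
noncomputable def toPi1 {x z : 𝒢.Y} (p : 𝒢.Word x z) :
    (CategoryTheory.Quotient.functor (𝒢.PiRel T)).obj (𝒢.unit T x) ⟶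
      (CategoryTheory.Quotient.functor (𝒢.PiRel T)).obj (𝒢.unit T z) :=
  (CategoryTheory.Quotient.functor (𝒢.PiRel T)).map (p.eval T)

end Word

end GraphOfGroupoids

/-! The method is van der Waerden's: instead of choosing coset representatives and normal forms, the
generators are made to act by left multiplication on words without pinches. Such words are taken
modulo shuffles, which replace `α_e(k) e` by `e α_{bar e}(k)`; a shuffle changes neither the edge
sequence nor a word of length 0. Multiplying by an edge either prefixes it or resolves the one pinch
that can arise at the front. Modulo shuffles this is a bijection and respects the conjugation
relation (`edgeMul_edgeMul_bar`, `edgeMul_vertMul`).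

The groupoids live over the root units, so each bijection is conjugated by the actions of tree words
leading to the root. Tree edges then act trivially, and `π₁` acts on classes of words. An element
acts as the identity after conjugation exactly when the unconjugated bijection is the action of a
tree word `q` (`conj_eq_eqToHom_iff`). If `p` represents a unit, applying both actions to the
trivial word shows that `p` and `q` have the same class, hence the same edges: a path without
backtracking in `T`. If `p` is closed, that path is empty, so `p` is a single unit, which
reducedness forbids.

In the free groupoid, a functor to the free group on the vertices shows that a word representing a
unit is closed, which reduces this case to `π₁`. -/

namespace GraphOfGroupoids

variable {V : Type uV} {E : Type uE} {Γ : SerreGraph V E}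
  {𝒢 : GraphOfGroupoids.{uV, uE, uG, vG, uH, vH} Γ}

/-! ### Arrows that correspond to each other across an edge -/

theorem isIso_hom {x y : 𝒢.Y} (g : x ⟶ y) : IsIso g := by
  obtain ⟨v, x⟩ := x
  obtain ⟨w, y⟩ := y
  change Sigma.SigmaHom _ _ at g
  cases g with
  | mk g => exact ((Sigma.incl (C := 𝒢.vert) v).mapIso ((Groupoid.isoEquivHom _ _).symm g)).isIso_hom

attribute [local instance] isIso_hom

theorem EdgeRel.left_unique {e : E} {y y' x : 𝒢.Y} (h : 𝒢.EdgeRel e y x)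
    (h₂ : 𝒢.EdgeRel e y' x) : y = y' :=
  h.symm.right_unique h₂.symm

variable (𝒢) in
/-- `𝒢.ArrowRel e f m n`, for two edges `e`, `f` over the same unoriented edge: there is an
arrow `k` of the edge groupoid with `m = α_e(k)` and `n = α_f(k)`. -/
inductive ArrowRel (e f : E) : ∀ {y y' x x' : 𝒢.Y}, (y ⟶ y') → (x ⟶ x') → Prop
  | mk (u : Γ.UEdge) (h : Γ.uedge e = u) (h' : Γ.uedge f = u) {a b : 𝒢.edge u} (k : a ⟶ b) :
      ArrowRel e f ((𝒢.incl u e h).map k) ((𝒢.incl u f h').map k)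

namespace ArrowRel

variable {e f : E} {y y' y'' x x' x'' : 𝒢.Y}

theorem symm {m : y ⟶ y'} {n : x ⟶ x'} (h : 𝒢.ArrowRel e f m n) : 𝒢.ArrowRel f e n m := by
  cases h with
  | mk u h h' k => exact mk u h' h k

theorem inH {m : y ⟶ y'} {n : x ⟶ x'} (h : 𝒢.ArrowRel e f m n) : 𝒢.InH e m := by
  cases h with
  | mk u h h' k => exact .mk u h k

theorem id (h : 𝒢.EdgeRel e y x) : 𝒢.ArrowRel e (Γ.bar e) (𝟙 y) (𝟙 x) := by
  obtain ⟨u, h, h', z, rfl, rfl⟩ := h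
  have := mk (𝒢 := 𝒢) u h h' (𝟙 z)
  rwa [CategoryTheory.Functor.map_id, CategoryTheory.Functor.map_id] at this

theorem inv {m : y ⟶ y'} {n : x ⟶ x'} (h : 𝒢.ArrowRel e f m n) :
    𝒢.ArrowRel e f (CategoryTheory.inv m) (CategoryTheory.inv n) := by
  cases h with
  | mk u h h' k =>
    rw [← Functor.map_inv, ← Functor.map_inv]
    exact mk u h h' _

/-- The two edge arrows become composable because `α_e` is injective on units. The separate middle
units keep the indices free for case analysis. -/
theorem comp_heq {y₁ x₁ : 𝒢.Y} {m : y ⟶ y'} {n : x ⟶ x'} {m' : y₁ ⟶ y''} {n' : x₁ ⟶ x''}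
    (h : 𝒢.ArrowRel e f m n) (h₁ : 𝒢.ArrowRel e f m' n') (hy : y' = y₁) (hx : x' = x₁) :
    𝒢.ArrowRel e f (m ≫ eqToHom hy ≫ m') (n ≫ eqToHom hx ≫ n') := by
  cases h with
  | mk u h h' k =>
    cases h₁ with
    | mk u₁ h₁ h₁' k₁ =>
      subst h h₁
      have := 𝒢.obj_injective _ e rfl (eq_of_heq (Sigma.mk.inj hy).2)
      subst this
      have := mk (𝒢 := 𝒢) _ rfl h' (k ≫ k₁)
      rw [Functor.map_comp, Functor.map_comp] at this
      rwa [eqToHom_refl, eqToHom_refl, Category.id_comp, Category.id_comp]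

theorem comp {m : y ⟶ y'} {n : x ⟶ x'} {m' : y' ⟶ y''} {n' : x' ⟶ x''}
    (h : 𝒢.ArrowRel e f m n) (h₁ : 𝒢.ArrowRel e f m' n') :
    𝒢.ArrowRel e f (m ≫ m') (n ≫ n') := by
  simpa using h.comp_heq h₁ rfl rfl

/-- Injectivity of `α_f` on units and arrows recovers the edge arrow from `n`, and with it `m`. -/
theorem left_heq {y₁ y₁' x₁ x₁' : 𝒢.Y} {m : y ⟶ y'} {n : x ⟶ x'} {m' : y₁ ⟶ y₁'}
    {n' : x₁ ⟶ x₁'} (h : 𝒢.ArrowRel e f m n) (h₁ : 𝒢.ArrowRel e f m' n') (hx : x = x₁)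
    (hx' : x' = x₁') (hn : HEq n n') : HEq m m' := by
  cases h with
  | mk u h h' k =>
    cases h₁ with
    | mk u₁ h₁ h₁' k₁ =>
      subst h h₁
      have h1 := 𝒢.obj_injective _ f h' (eq_of_heq (Sigma.mk.inj hx).2)
      have h2 := 𝒢.obj_injective _ f h' (eq_of_heq (Sigma.mk.inj hx').2)
      subst h1 h2
      have := 𝒢.faithful _ f h'
      rw [(𝒢.incl _ f h').map_injective (eq_of_heq hn)]

theorem left_unique {m m' : y ⟶ y'} {n : x ⟶ x'} (h : 𝒢.ArrowRel e f m n)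
    (h₁ : 𝒢.ArrowRel e f m' n) : m = m' :=
  eq_of_heq (h.left_heq h₁ rfl rfl HEq.rfl)

end ArrowRel

/-- If `n = α_{bar e}(k)`, then `m = α_e(k)`; its ends are the prescribed ones because `φ_e` is a
function. -/
theorem InH.exists_arrowRel {e : E} {y y' x x' : 𝒢.Y} {n : x ⟶ x'} (hn : 𝒢.InH (Γ.bar e) n)
    (h : 𝒢.EdgeRel e y x) (h' : 𝒢.EdgeRel e y' x') :
    ∃ m : y ⟶ y', 𝒢.ArrowRel e (Γ.bar e) m n := by
  cases hn with
  | mk u hu k =>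
    have hu' : Γ.uedge e = u := by rw [← Γ.uedge_bar, hu]
    obtain rfl := h.left_unique (edgeRel_incl u e hu' hu _)
    obtain rfl := h'.left_unique (edgeRel_incl u e hu' hu _)
    exact ⟨_, .mk u hu' hu k⟩

namespace InH

variable {e : E} {x y z : 𝒢.Y} {m : x ⟶ y} {g : y ⟶ z}

/-- The diagonal case of `ArrowRel` yields the closure of `ℋ_e` under products and inverses. -/
theorem arrowRel_self (h : 𝒢.InH e m) : 𝒢.ArrowRel e e m m := by
  cases h with
  | mk u h k => exact .mk u h h k

theorem comp (hm : 𝒢.InH e m) (hg : 𝒢.InH e g) : 𝒢.InH e (m ≫ g) :=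
  (hm.arrowRel_self.comp hg.arrowRel_self).inH

theorem inv (hm : 𝒢.InH e m) : 𝒢.InH e (CategoryTheory.inv m) :=
  hm.arrowRel_self.inv.inH

theorem of_comp_left (hm : 𝒢.InH e m) (h : 𝒢.InH e (m ≫ g)) : 𝒢.InH e g := by
  simpa using hm.inv.comp h

theorem of_comp_right (hg : 𝒢.InH e g) (h : 𝒢.InH e (m ≫ g)) : 𝒢.InH e m := by
  simpa using h.comp hg.inv

end InH

/-! ### Left multiplication on words, and shuffles -/

namespace Word

variable {x y z : 𝒢.Y}

/-- Left multiplication of a word by an arrow of a vertex groupoid. -/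
def vertMul (g : x ⟶ y) : 𝒢.Word y z → 𝒢.Word x z
  | nil g₁ => nil (g ≫ g₁)
  | cons g₁ e h p => cons (g ≫ g₁) e h p

theorem vertMul_vertMul {w : 𝒢.Y} (g : w ⟶ x) (g' : x ⟶ y) (p : 𝒢.Word y z) :
    vertMul g (vertMul g' p) = vertMul (g ≫ g') p := by
  cases p <;> simp [vertMul]

theorem id_vertMul (p : 𝒢.Word y z) : vertMul (𝟙 y) p = p := by
  cases p <;> simp [vertMul]

theorem edges_vertMul (g : x ⟶ y) (p : 𝒢.Word y z) : (vertMul g p).edges = p.edges := by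
  cases p <;> rfl

/-- No edge precedes the first letter, so `NoPinch` does not test it. -/
theorem noPinch_vertMul (g : x ⟶ y) {p : 𝒢.Word y z} (hp : p.NoPinch) :
    (vertMul g p).NoPinch := by
  cases p <;> exact hp

open Classical in
/-- Left multiplication of a word by an edge, where a pinch at the beginning is resolved. -/
noncomputable def edgeMul (e : E) (h : 𝒢.EdgeRel e y x) : 𝒢.Word x z → 𝒢.Word y z
  | nil g => cons (𝟙 y) e h (nil g)
  | cons (y' := a') g f h' q =>
      if H : f = Γ.bar e ∧ ∃ m : y ⟶ a', 𝒢.ArrowRel e (Γ.bar e) m g then vertMul H.2.choose q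
      else cons (𝟙 y) e h (cons g f h' q)

/-- The arrow chosen in `edgeMul` is forced, by uniqueness of `m`. -/
theorem edgeMul_of_arrowRel {e : E} (h : 𝒢.EdgeRel e y x) {a a' : 𝒢.Y} {g : x ⟶ a}
    (h' : 𝒢.EdgeRel (Γ.bar e) a a') (q : 𝒢.Word a' z) {m : y ⟶ a'}
    (hm : 𝒢.ArrowRel e (Γ.bar e) m g) :
    edgeMul e h (cons g (Γ.bar e) h' q) = vertMul m q := by
  have H : Γ.bar e = Γ.bar e ∧ ∃ m : y ⟶ a', 𝒢.ArrowRel e (Γ.bar e) m g := ⟨rfl, m, hm⟩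
  rw [edgeMul, dif_pos H, H.2.choose_spec.left_unique hm]

theorem edgeMul_of_not_pinch {e : E} (h : 𝒢.EdgeRel e y x) {p : 𝒢.Word x z}
    (hp : p.edges.head? = some (Γ.bar e) → p.HeadNotInH (Γ.bar e)) :
    edgeMul e h p = cons (𝟙 y) e h p := by
  cases p with
  | nil g => rfl
  | cons g f h' q =>
    rw [edgeMul, dif_neg]
    rintro ⟨rfl, m, hm⟩
    exact hp rfl hm.symm.inH

theorem pinch_cases {e : E} (h : 𝒢.EdgeRel e y x) (p : 𝒢.Word x z) :
    (p.edges.head? = some (Γ.bar e) → p.HeadNotInH (Γ.bar e)) ∨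
      ∃ (a a' : 𝒢.Y) (g : x ⟶ a) (h' : 𝒢.EdgeRel (Γ.bar e) a a') (q : 𝒢.Word a' z) (m : y ⟶ a'),
        𝒢.ArrowRel e (Γ.bar e) m g ∧ p = cons g (Γ.bar e) h' q := by
  cases p with
  | nil g => exact Or.inl nofun
  | @cons _ a a' _ g f h' q =>
    by_cases hf : f = Γ.bar e
    · subst hf
      by_cases hg : 𝒢.InH (Γ.bar e) g
      · have h'' : 𝒢.EdgeRel e a' a := by simpa only [Γ.bar_bar] using h'.symm
        obtain ⟨m, hm⟩ := hg.exists_arrowRel h h''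
        exact Or.inr ⟨a, a', g, h', q, m, hm, rfl⟩
      · exact Or.inl fun _ => hg
    · refine Or.inl fun h => absurd ?_ hf
      simpa [edges] using h

theorem noPinch_edgeMul {e : E} (h : 𝒢.EdgeRel e y x) {p : 𝒢.Word x z} (hp : p.NoPinch) :
    (edgeMul e h p).NoPinch := by
  rcases pinch_cases h p with H | ⟨a, a', g, h', q, m, hm, rfl⟩
  · rw [edgeMul_of_not_pinch h H]
    exact ⟨H, hp⟩
  · rw [edgeMul_of_arrowRel h h' q hm]
    exact noPinch_vertMul m hp.2

/-- `p'` arises from `p` by moving an element of an edge groupoid across one edge. -/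
inductive Shuffle {z : 𝒢.Y} : ∀ {x : 𝒢.Y}, 𝒢.Word x z → 𝒢.Word x z → Prop
  | head {x y y₁ w w₁ : 𝒢.Y} (g : x ⟶ y) (e : E) (h : 𝒢.EdgeRel e y w)
      (h₁ : 𝒢.EdgeRel e y₁ w₁) {m : y ⟶ y₁} {n : w ⟶ w₁} (hm : 𝒢.ArrowRel e (Γ.bar e) m n)
      (p : 𝒢.Word w₁ z) : Shuffle (cons (g ≫ m) e h₁ p) (cons g e h (vertMul n p))
  | tail {x y w : 𝒢.Y} (g : x ⟶ y) (e : E) (h : 𝒢.EdgeRel e y w) {p p' : 𝒢.Word w z}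
      (hp : Shuffle p p') : Shuffle (cons g e h p) (cons g e h p')

theorem Shuffle.edges_eq {p p' : 𝒢.Word x z} (h : Shuffle p p') : p.edges = p'.edges := by
  induction h with
  | head => simp [edges, edges_vertMul]
  | tail g e h _ ih => simp [edges, ih]

theorem Shuffle.vertMul (g : x ⟶ y) {p p' : 𝒢.Word y z} (h : Shuffle p p') :
    Shuffle (vertMul g p) (Word.vertMul g p') := by
  cases h with
  | head g' e h h₁ hm p =>
    simp only [Word.vertMul, ← Category.assoc]
    exact .head _ e h h₁ hm p
  | tail g' e h hp => exact .tail _ e h hp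

/-- A shuffle across the very edge that is cancelled disappears, since both results absorb the same
element; any other shuffle survives. -/
theorem Shuffle.edgeMul {e : E} (h : 𝒢.EdgeRel e y x) {p p' : 𝒢.Word x z} (hp : Shuffle p p') :
    Word.edgeMul e h p = Word.edgeMul e h p' ∨
      Shuffle (Word.edgeMul e h p) (Word.edgeMul e h p') := by
  have hs := hp
  cases hp with
  | @head _ a b c d g f hf hf₁ m n hm q =>
    rcases pinch_cases h (cons g f hf (Word.vertMul n q)) with H | ⟨_, _, _, h', q', k, hk, H⟩
    · right
      rw [edgeMul_of_not_pinch h H, edgeMul_of_not_pinch h]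
      · exact .tail _ _ _ hs
      · intro hh
        have hh' : f = Γ.bar e := by simpa [edges] using hh
        subst hh'
        -- As `m` lies in `ℋ_{bar e}`, membership of `g ≫ m` there forces that of `g`: a shuffle
        -- creates no pinch.
        exact fun hg => H rfl (hm.inH.of_comp_right hg)
    · left
      cases H
      rw [edgeMul_of_arrowRel h h' _ hk, vertMul_vertMul]
      rw [edgeMul_of_arrowRel h hf₁ _ (m := k ≫ n) (hk.comp ?_)]
      simpa only [Γ.bar_bar] using hm.symm
  | @tail _ a b g f hf q q' hq =>
    right
    rcases pinch_cases h (cons g f hf q) with H | ⟨_, _, _, h', q', k, hk, H⟩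
    · rw [edgeMul_of_not_pinch h H, edgeMul_of_not_pinch h]
      · exact .tail _ _ _ hs
      · exact fun hh => H hh
    · cases H
      rw [edgeMul_of_arrowRel h h' _ hk, edgeMul_of_arrowRel h h' _ hk]
      exact hq.vertMul k

/-- If `bar e` is merely prefixed, `e` cancels it again. If `bar e` cancels against `p = g e q` with
`g ∈ ℋ_e`, the result `m q` has no pinch with `e` since `p` had none, and `e m q` is a shuffle of `g
e q`. -/
theorem edgeMul_edgeMul_bar {e : E} (h : 𝒢.EdgeRel e y x) (h' : 𝒢.EdgeRel (Γ.bar e) x y)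
    {p : 𝒢.Word y z} (hp : p.NoPinch) :
    edgeMul e h (edgeMul (Γ.bar e) h' p) = p ∨
      Shuffle p (edgeMul e h (edgeMul (Γ.bar e) h' p)) := by
  rcases pinch_cases h' p with H | ⟨a, a', g, h₁, q, m, hm, rfl⟩
  · left
    rw [edgeMul_of_not_pinch h' H, edgeMul_of_arrowRel h h' _ (.id h), id_vertMul]
  · right
    rw [edgeMul_of_arrowRel h' h₁ q hm]
    have hq : (vertMul m q).edges.head? = some (Γ.bar e) →
        (vertMul m q).HeadNotInH (Γ.bar e) := by
      rw [edges_vertMul]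
      intro hh
      have := hp.1 (by rw [hh, Γ.bar_bar])
      rw [Γ.bar_bar] at this
      cases q with
      | nil g' => exact fun H => this (hm.inH.of_comp_left H)
      | cons g' _ _ _ => exact fun H => this (hm.inH.of_comp_left H)
    rw [edgeMul_of_not_pinch h hq]
    revert h₁
    rw [Γ.bar_bar]
    intro h₁ _
    have := Shuffle.head (𝟙 y) e h h₁ (m := g) (n := m) ?_ q
    · rwa [Category.id_comp] at this
    · have := hm.symm
      rwa [Γ.bar_bar] at this

/-- This is `e n = m e`, the conjugation relation. Since `n ∈ ℋ_{bar e}`, both sides have a pinch or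
neither has; only in the latter case is a shuffle needed. -/
theorem edgeMul_vertMul {e : E} {y' x' : 𝒢.Y} {m : y ⟶ y'} {n : x ⟶ x'}
    (h : 𝒢.EdgeRel e y x) (h' : 𝒢.EdgeRel e y' x') (hm : 𝒢.ArrowRel e (Γ.bar e) m n)
    (p : 𝒢.Word x' z) :
    edgeMul e h (vertMul n p) = vertMul m (edgeMul e h' p) ∨
      Shuffle (vertMul m (edgeMul e h' p)) (edgeMul e h (vertMul n p)) := by
  rcases pinch_cases h' p with H | ⟨a, a', g, h₁, q, k, hk, rfl⟩
  · right
    have hn : 𝒢.InH (Γ.bar e) n := hm.symm.inH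
    rw [edgeMul_of_not_pinch h' H, edgeMul_of_not_pinch h]
    · have := Shuffle.head (𝟙 y) e h h' hm p
      rw [Category.id_comp] at this
      simpa [vertMul] using this
    · rw [edges_vertMul]
      intro hh
      have := H hh
      cases p with
      | nil g' => exact fun H => this (hn.of_comp_left H)
      | cons g' _ _ _ => exact fun H => this (hn.of_comp_left H)
  · left
    rw [edgeMul_of_arrowRel h' h₁ q hk, vertMul_vertMul]
    exact edgeMul_of_arrowRel h h₁ q (hm.comp hk)

end Word
-- Classes of words and the bijections induced by the generators
/-- The words from `x` to `z` without pinches, up to shuffles. -/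
def State (z x : 𝒢.Y) : Type (max uV uE uG vG) :=
  Quot fun p p' : {p : 𝒢.Word x z // p.NoPinch} => Word.Shuffle p.1 p'.1

namespace State

variable {w x y z : 𝒢.Y}

/-- The class of a word without pinches. -/
def mk (p : 𝒢.Word x z) (hp : p.NoPinch) : State z x :=
  Quot.mk _ ⟨p, hp⟩

theorem ind {P : State z x → Prop} (h : ∀ p hp, P (mk p hp)) (s : State z x) : P s :=
  Quot.ind (fun p => h p.1 p.2) s

theorem mk_eq {p p' : 𝒢.Word x z} (hp : p.NoPinch) (hp' : p'.NoPinch)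
    (h : p = p' ∨ Word.Shuffle p p') : mk p hp = mk p' hp' := by
  rcases h with rfl | h
  · rfl
  · exact Quot.sound h

/-- The sequence of edges is invariant under shuffles. -/
def edges (s : State z x) : List E :=
  Quot.lift (fun p => p.1.edges) (fun _ _ h => h.edges_eq) s

/-- A word of length zero is determined by its class. -/
theorem mk_nil_injective {g g' : x ⟶ z} (h : mk (.nil g) trivial = mk (.nil g') trivial) :
    g = g' := by
  -- Being the word `nil g'` is a property of classes, because both sides of a shuffle contain an
  -- edge.
  let F : State z x → Prop := fun s => Quot.lift
    (fun p => p.1 = .nil g') (fun p p' h => by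
      obtain ⟨p, hp⟩ := p
      obtain ⟨p', hp'⟩ := p'
      change Word.Shuffle p p' at h
      cases h <;> simp) s
  have h1 : F (mk (.nil g') trivial) := rfl
  rw [← h] at h1
  exact Word.nil.inj h1

/-- The action of an arrow of a vertex groupoid. -/
def vertMap (g : x ⟶ y) : State z y → State z x :=
  Quot.map (fun p => ⟨.vertMul g p.1, Word.noPinch_vertMul g p.2⟩) fun _ _ h => h.vertMul g

theorem vertMap_vertMap (g : w ⟶ x) (g' : x ⟶ y) (s : State z y) :
    vertMap g (vertMap g' s) = vertMap (g ≫ g') s := by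
  induction s using ind with
  | h p hp => exact mk_eq _ _ (.inl (Word.vertMul_vertMul g g' p))

theorem vertMap_id (s : State z y) : vertMap (𝟙 y) s = s := by
  induction s using ind with
  | h p hp => exact mk_eq _ _ (.inl (Word.id_vertMul p))

/-- The action of an edge. -/
noncomputable def edgeMap (e : E) (h : 𝒢.EdgeRel e y x) : State z x → State z y :=
  Quot.lift (fun p => mk (.edgeMul e h p.1) (Word.noPinch_edgeMul h p.2))
    fun _ _ hp => mk_eq _ _ (hp.edgeMul h)

theorem edgeMap_edgeMap_bar (e : E) (h : 𝒢.EdgeRel e y x) (s : State z y) :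
    edgeMap e h (edgeMap (Γ.bar e) h.symm s) = s := by
  induction s using ind with
  | h p hp => exact (mk_eq hp _ ((Word.edgeMul_edgeMul_bar h h.symm hp).imp Eq.symm id)).symm

theorem edgeMap_bar_edgeMap (e : E) (h : 𝒢.EdgeRel e y x) (s : State z x) :
    edgeMap (Γ.bar e) h.symm (edgeMap e h s) = s := by
  have H : ∀ f, f = e → ∀ (h' : 𝒢.EdgeRel f y x), edgeMap f h' s = edgeMap e h s := by
    rintro f rfl h'
    rfl
  rw [← H _ (Γ.bar_bar e) h.symm.symm, edgeMap_edgeMap_bar]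

theorem edgeMap_vertMap {e : E} {y' x' : 𝒢.Y} {m : y ⟶ y'} {n : x ⟶ x'}
    (h : 𝒢.EdgeRel e y x) (h' : 𝒢.EdgeRel e y' x') (hm : 𝒢.ArrowRel e (Γ.bar e) m n)
    (s : State z x') : edgeMap e h (vertMap n s) = vertMap m (edgeMap e h' s) := by
  induction s using ind with
  | h p hp => exact (mk_eq _ _ ((Word.edgeMul_vertMul h h' hm p).imp Eq.symm id)).symm

variable (z) in
/-- `vertMap` as a bijection. -/
noncomputable def vertEquiv (g : x ⟶ y) : State z y ≃ State z x where
  toFun := vertMap g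
  invFun := vertMap (inv g)
  left_inv s := by rw [vertMap_vertMap, IsIso.inv_hom_id, vertMap_id]
  right_inv s := by rw [vertMap_vertMap, IsIso.hom_inv_id, vertMap_id]

variable (z) in
/-- `edgeMap` as a bijection. -/
noncomputable def edgeEquiv (e : E) (h : 𝒢.EdgeRel e y x) : State z x ≃ State z y where
  toFun := edgeMap e h
  invFun := edgeMap (Γ.bar e) h.symm
  left_inv s := edgeMap_bar_edgeMap e h s
  right_inv s := edgeMap_edgeMap_bar e h s

theorem vertEquiv_id : vertEquiv z (𝟙 x) = Equiv.refl _ :=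
  Equiv.ext vertMap_id

theorem vertEquiv_comp (g : w ⟶ x) (g' : x ⟶ y) :
    vertEquiv z (g ≫ g') = (vertEquiv z g').trans (vertEquiv z g) :=
  Equiv.ext fun s => (vertMap_vertMap g g' s).symm

theorem edgeEquiv_bar (e : E) (h : 𝒢.EdgeRel e y x) :
    edgeEquiv z (Γ.bar e) h.symm = (edgeEquiv z e h).symm :=
  Equiv.ext fun _ => rfl

theorem vertEquiv_trans_edgeEquiv {e : E} {y' x' : 𝒢.Y} {m : y ⟶ y'} {n : x ⟶ x'}
    (h : 𝒢.EdgeRel e y x) (h' : 𝒢.EdgeRel e y' x') (hm : 𝒢.ArrowRel e (Γ.bar e) m n) :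
    (vertEquiv z n).trans (edgeEquiv z e h) = (edgeEquiv z e h').trans (vertEquiv z m) :=
  Equiv.ext fun s => edgeMap_vertMap h h' hm s

end State

/-! ### The action of words, and words along the tree -/

namespace Word

variable {x y z : 𝒢.Y}

variable (z) in
/-- The action of a word. -/
noncomputable def act : ∀ {x y : 𝒢.Y}, 𝒢.Word x y → (State z y ≃ State z x)
  | _, _, nil g => State.vertEquiv z g
  | _, _, cons g e h p => (p.act.trans (State.edgeEquiv z e h)).trans (State.vertEquiv z g)

/-- The word is rebuilt from its last letter to its first, and without pinches nothing cancels on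
the way. Thus the action of `p` remembers its class. -/
theorem act_apply_nil_id (p : 𝒢.Word x z) (hp : p.NoPinch) :
    p.act z (.mk (.nil (𝟙 z)) trivial) = .mk p hp := by
  induction p with
  | nil g => exact State.mk_eq _ _ (.inl (by simp [vertMul]))
  | cons g e h p ih =>
    rw [act, Equiv.trans_apply, Equiv.trans_apply, ih hp.2]
    refine State.mk_eq _ _ (.inl ?_)
    change vertMul g (edgeMul e h p) = _
    rw [edgeMul_of_not_pinch h hp.1]
    simp [vertMul]

/-- All vertex letters of the word are units. -/
inductive IsTransport : ∀ {x y : 𝒢.Y}, 𝒢.Word x y → Prop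
  | nil (x : 𝒢.Y) : IsTransport (nil (𝟙 x))
  | cons {x y z : 𝒢.Y} (e : E) (h : 𝒢.EdgeRel e x y) {p : 𝒢.Word y z} (hp : IsTransport p) :
      IsTransport (cons (𝟙 x) e h p)

/-- The word is given by a path without backtracking in the tree `T`. -/
structure IsTreeWord (T : Γ.RootedMaximalSubtree) (p : 𝒢.Word x y) : Prop where
  isTransport : p.IsTransport
  isReduced : Γ.IsReduced p.edges
  mem_edges : ∀ e ∈ p.edges, e ∈ T.edges

theorem isPath_edges (p : 𝒢.Word x y) : Γ.IsPath x.1 y.1 p.edges := by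
  have aux : ∀ {x y : 𝒢.Y} (g : x ⟶ y), x.1 = y.1 := by
    intro x y g
    change Sigma.SigmaHom _ _ at g
    cases g
    rfl
  induction p with
  | nil g => exact aux g
  | cons g e h p ih => exact ⟨h.fst_left.symm.trans (aux g).symm, h.fst_right ▸ ih⟩

theorem IsTransport.eq {p q : 𝒢.Word x y} (hp : p.IsTransport) (hq : q.IsTransport)
    (h : p.edges = q.edges) : p = q := by
  induction hp with
  | nil x =>
    cases hq with
    | nil => rfl
    | cons => simp [edges] at h
  | cons e h' hp ih =>
    cases hq with
    | nil => simp [edges] at h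
    | cons f h'' hq =>
      simp only [edges, List.cons.injEq] at h
      obtain ⟨rfl, h⟩ := h
      obtain rfl := h'.right_unique h''
      rw [ih hq h]

variable {T : Γ.RootedMaximalSubtree}

/-- Paths without backtracking in `T` are unique, and each `φ_e` determines the next unit. -/
theorem IsTreeWord.eq {p q : 𝒢.Word x y} (hp : p.IsTreeWord T) (hq : q.IsTreeWord T) : p = q :=
  hp.1.eq hq.1 ((T.maximal.1 _ (T.mem_verts 𝒢.connected _) _ (T.mem_verts 𝒢.connected _)).unique
    ⟨p.isPath_edges, hp.2, hp.3⟩ ⟨q.isPath_edges, hq.2, hq.3⟩)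

theorem IsTreeWord.noPinch {p : 𝒢.Word x y} (hp : p.IsTreeWord T) : p.NoPinch := by
  have H : Γ.IsReduced p.edges → p.NoPinch := by
    clear hp
    intro hr
    induction p with
    | nil => trivial
    | cons g e h p ih =>
      have := List.isChain_cons.1 hr
      exact ⟨fun hh => absurd rfl (this.1 _ hh), ih this.2⟩
  exact H hp.2

theorem isTreeWord_nil (x : 𝒢.Y) : (nil (𝟙 x)).IsTreeWord T :=
  ⟨.nil x, .nil, by simp [edges]⟩

/-- Either `p` begins with `bar e`, which is cancelled, or `e` is prefixed without creating
backtracking. -/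
theorem IsTreeWord.exists_cons {e : E} (he : e ∈ T.edges) (h : 𝒢.EdgeRel e y x)
    {p : 𝒢.Word x z} (hp : p.IsTreeWord T) :
    ∃ q : 𝒢.Word y z, q.IsTreeWord T ∧
      ∀ c, q.act c = (p.act c).trans (State.edgeEquiv c e h) := by
  by_cases hh : p.edges.head? = some (Γ.bar e)
  · obtain ⟨h1, h2, h3⟩ := hp
    cases h1 with
    | nil => simp [edges] at hh
    | @cons _ w _ f h' q hq =>
      have hf : f = Γ.bar e := by simpa [edges] using hh
      subst hf
      obtain rfl := h'.right_unique h.symm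
      refine ⟨q, ⟨hq, h2.tail, fun f hf => h3 f (List.mem_cons_of_mem _ hf)⟩, fun c => ?_⟩
      rw [act, State.vertEquiv_id, State.edgeEquiv_bar _ h]
      ext s
      simp
  · refine ⟨cons (𝟙 y) e h p, ⟨.cons e h hp.1, ?_, ?_⟩, fun c => ?_⟩
    · refine List.isChain_cons.2 ⟨?_, hp.2⟩
      rintro f hf rfl
      exact hh hf
    · intro f hf
      rcases List.mem_cons.1 hf with rfl | hf
      · exact he
      · exact hp.3 f hf
    · rw [act, State.vertEquiv_id]
      rfl

/-- This is `p⁻¹ q`: the edges of `p` are stripped one at a time, and their inverses multiplied onto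
`q`. -/
theorem IsTreeWord.exists_symm_trans {w : 𝒢.Y} {p : 𝒢.Word x y} (hp : p.IsTreeWord T)
    {q : 𝒢.Word x w} (hq : q.IsTreeWord T) :
    ∃ k : 𝒢.Word y w, k.IsTreeWord T ∧ ∀ c, k.act c = (q.act c).trans (p.act c).symm := by
  obtain ⟨h1, -, h3⟩ := hp
  induction h1 with
  | nil x =>
    refine ⟨q, hq, fun c => ?_⟩
    rw [act, State.vertEquiv_id]
    rfl
  | @cons x₁ x₂ x₃ e h p' hp' ih =>
    have he := T.bar_mem e (h3 e List.mem_cons_self)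
    obtain ⟨k, hk, hk'⟩ := hq.exists_cons he h.symm
    obtain ⟨l, hl, hl'⟩ := ih hk fun f hf => h3 f (List.mem_cons_of_mem _ hf)
    refine ⟨l, hl, fun c => ?_⟩
    rw [hl', hk', act, State.vertEquiv_id, State.edgeEquiv_bar _ h]
    rfl

/-- The product `p q` is obtained as `(p⁻¹)⁻¹ q`. -/
theorem IsTreeWord.exists_trans {w : 𝒢.Y} {p : 𝒢.Word x y} (hp : p.IsTreeWord T)
    {q : 𝒢.Word y w} (hq : q.IsTreeWord T) :
    ∃ k : 𝒢.Word x w, k.IsTreeWord T ∧ ∀ c, k.act c = (q.act c).trans (p.act c) := by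
  obtain ⟨p', hp', h⟩ := hp.exists_symm_trans (isTreeWord_nil x)
  obtain ⟨k, hk, hk'⟩ := hp'.exists_symm_trans hq
  refine ⟨k, hk, fun c => ?_⟩
  rw [hk', h, act, State.vertEquiv_id]
  rfl

theorem exists_isTreeWord (T : Γ.RootedMaximalSubtree) (h : 𝒢.TreeRel T y x) :
    ∃ p : 𝒢.Word y x, p.IsTreeWord T := by
  obtain ⟨l, ⟨-, hr, hl⟩, ht⟩ := h
  have : ∃ p : 𝒢.Word y x, p.IsTransport ∧ p.edges = l := by
    clear hr hl
    induction l generalizing y with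
    | nil =>
      obtain rfl : y = x := ht
      exact ⟨_, .nil _, rfl⟩
    | cons e l ih =>
      obtain ⟨y', h, ht⟩ := ht
      obtain ⟨p, hp, rfl⟩ := ih ht
      exact ⟨_, .cons e h hp, rfl⟩
  obtain ⟨p, hp, rfl⟩ := this
  exact ⟨p, hp, hr, hl⟩

end Word
end GraphOfGroupoids

/-! ### The action of the fundamental groupoid on classes of words -/

theorem IsUnitArrow.map {C D : Type*} [Category C] [Category D] (F : C ⥤ D) {a b : C} {f : a ⟶ b}
    (hf : IsUnitArrow f) : IsUnitArrow (F.map f) := by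
  obtain ⟨rfl, rfl⟩ := hf
  exact ⟨rfl, by simp⟩

theorem Quiver.FreeGroupoid.lift_map_of {V : Type*} [Quiver V] {V' : Type*} [Groupoid V']
    (φ : V ⥤q V') {a b : V} (f : a ⟶ b) :
    (Quiver.FreeGroupoid.lift φ).map ((Quiver.FreeGroupoid.of V).map f) = φ.map f := by
  exact Paths.lift_toPath (Quiver.Symmetrify.lift φ) f.toPos

/-- The groupoid of types, with the bijections `B ≃ A` as arrows from `A` to `B`. -/
structure TypeGpd.{u} : Type (u + 1) where
  carrier : Type u

/-- With the arrows reversed, `f ≫ g` is the map `f ∘ g`, so left multiplication is covariant. -/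
instance : Groupoid TypeGpd where
  Hom A B := B.carrier ≃ A.carrier
  id A := Equiv.refl _
  comp f g := g.trans f
  inv f := f.symm
  inv_comp f := f.self_trans_symm
  comp_inv f := f.symm_trans_self

namespace GraphOfGroupoids

variable {V : Type uV} {E : Type uE} {Γ : SerreGraph V E}
  (𝒢 : GraphOfGroupoids.{uV, uE, uG, vG, uH, vH} Γ) (T : Γ.RootedMaximalSubtree)

/-- The unit of the root groupoid given by an element of the unit space. -/
def rootUnit (r : 𝒢.UnitSpace T) : 𝒢.Y :=
  ⟨T.root, r⟩

/-- The word along the path in the tree from a unit to the root. -/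
noncomputable def toRoot (y : 𝒢.Y) : 𝒢.Word y (𝒢.rootUnit T (𝒢.tau T y)) :=
  (Word.exists_isTreeWord T ((tau_eq_iff T y _).1 rfl)).choose

theorem isTreeWord_toRoot (y : 𝒢.Y) : (𝒢.toRoot T y).IsTreeWord T :=
  (Word.exists_isTreeWord T ((tau_eq_iff T y _).1 rfl)).choose_spec

/-- The bijection between states attached to a bijection over the units `x` and `y`, transported
to the root. -/
noncomputable def conj (c : 𝒢.Y) {x y : 𝒢.Y} (f : State c y ≃ State c x) :
    TypeGpd.mk (State c (𝒢.rootUnit T (𝒢.tau T x))) ⟶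
      TypeGpd.mk (State c (𝒢.rootUnit T (𝒢.tau T y))) :=
  (((𝒢.toRoot T y).act c).trans f).trans ((𝒢.toRoot T x).act c).symm

theorem conj_comp (c : 𝒢.Y) {x y z : 𝒢.Y} (f : State c y ≃ State c x) (g : State c z ≃ State c y) :
    𝒢.conj T c f ≫ 𝒢.conj T c g = 𝒢.conj T c (g.trans f) := by
  refine Equiv.ext fun s => ?_
  change (𝒢.toRoot T x |>.act c).symm (f ((𝒢.toRoot T y).act c
    (((𝒢.toRoot T y).act c).symm (g ((𝒢.toRoot T z).act c s))))) = _
  rw [Equiv.apply_symm_apply]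
  rfl

theorem conj_refl (c : 𝒢.Y) (x : 𝒢.Y) : 𝒢.conj T c (Equiv.refl (State c x)) = 𝟙 _ :=
  Equiv.self_trans_symm _

/-- The action of the generators on the states. -/
noncomputable def genAct (c : 𝒢.Y) : 𝒢.UnitSpace T ⥤q TypeGpd.{max uV uE uG vG} where
  obj r := ⟨State c (𝒢.rootUnit T r)⟩
  map
    | .vert g => 𝒢.conj T c (State.vertEquiv c g)
    | .edge e h => 𝒢.conj T c (State.edgeEquiv c e h)

/-- The action of the free groupoid on the generators on the states. -/
noncomputable def genFunctor (c : 𝒢.Y) : 𝒢.GenGroupoid T ⥤ TypeGpd.{max uV uE uG vG} :=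
  Quiver.FreeGroupoid.lift (𝒢.genAct T c)

theorem genFunctor_vertGen (c : 𝒢.Y) {x y : 𝒢.Y} (g : x ⟶ y) :
    (𝒢.genFunctor T c).map (𝒢.vertGen T g) = 𝒢.conj T c (State.vertEquiv c g) :=
  Quiver.FreeGroupoid.lift_map_of _ _

theorem genFunctor_edgeGen (c : 𝒢.Y) (e : E) {y x : 𝒢.Y} (h : 𝒢.EdgeRel e y x) :
    (𝒢.genFunctor T c).map (𝒢.edgeGen T e h) = 𝒢.conj T c (State.edgeEquiv c e h) :=
  Quiver.FreeGroupoid.lift_map_of _ _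

theorem genFunctor_eval (c : 𝒢.Y) {x z : 𝒢.Y} (p : 𝒢.Word x z) :
    (𝒢.genFunctor T c).map (p.eval T) = 𝒢.conj T c (p.act c) := by
  induction p with
  | nil g => exact genFunctor_vertGen 𝒢 T c g
  | cons g e h p ih =>
    rw [Word.eval, Functor.map_comp, Functor.map_comp, genFunctor_vertGen, genFunctor_edgeGen, ih]
    erw [conj_comp, conj_comp]
    rfl

theorem genFunctor_eq_of_freeRel (c : 𝒢.Y) {a b : 𝒢.GenGroupoid T} {f g : a ⟶ b}
    (h : 𝒢.FreeRel T f g) : (𝒢.genFunctor T c).map f = (𝒢.genFunctor T c).map g := by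
  cases h with
  | vert_id x =>
    rw [genFunctor_vertGen, State.vertEquiv_id, CategoryTheory.Functor.map_id]
    exact conj_refl 𝒢 T c x
  | vert_comp g h =>
    rw [Functor.map_comp, genFunctor_vertGen, genFunctor_vertGen, genFunctor_vertGen,
      State.vertEquiv_comp]
    exact (conj_comp 𝒢 T c _ _).symm
  | edge_inv e h =>
    rw [Functor.map_comp, genFunctor_edgeGen, genFunctor_edgeGen, CategoryTheory.Functor.map_id]
    refine (conj_comp 𝒢 T c _ _).trans ?_
    rw [State.edgeEquiv_bar e h, Equiv.symm_trans_self]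
    exact conj_refl 𝒢 T c _
  | edge_conj u e h h' k =>
    rw [Functor.map_comp, Functor.map_comp, genFunctor_edgeGen, genFunctor_edgeGen,
      genFunctor_vertGen, genFunctor_vertGen]
    erw [conj_comp, conj_comp]
    congr 1
    -- With `e n = m e`, the product `e n bar e` becomes `m e bar e`, and `e bar e` cancels.
    rw [Equiv.trans_assoc, State.vertEquiv_trans_edgeEquiv _ (edgeRel_incl u e h h' _)
      (.mk u h h' k), State.edgeEquiv_bar e (edgeRel_incl u e h h' _),
      ← Equiv.trans_assoc, Equiv.symm_trans_self, Equiv.refl_trans]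

/-- With `p` and `q` the tree words from `x` and `y` to their common root unit, the conjugate of `f`
is trivial iff `f` acts as `p q⁻¹`. That product acts as a tree word from `x` to `y`, and there is
only one. -/
theorem conj_eq_eqToHom_iff (c : 𝒢.Y) {x y : 𝒢.Y} (h : 𝒢.tau T x = 𝒢.tau T y)
    (h' : TypeGpd.mk (State c (𝒢.rootUnit T (𝒢.tau T x))) =
      TypeGpd.mk (State c (𝒢.rootUnit T (𝒢.tau T y)))) (f : State c y ≃ State c x) :
    𝒢.conj T c f = eqToHom h' ↔ ∃ q : 𝒢.Word x y, q.IsTreeWord T ∧ f = q.act c := by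
  have hx := 𝒢.isTreeWord_toRoot T x
  have hy := 𝒢.isTreeWord_toRoot T y
  -- Only the tree word property of `toRoot` is kept, so that the two root units can be identified
  -- and `eqToHom h'` becomes the identity.
  unfold conj
  generalize 𝒢.toRoot T x = p at *
  generalize 𝒢.toRoot T y = q at *
  revert p q
  generalize 𝒢.tau T y = r at *
  subst h
  intro p hp q hq
  have key : ∃ k : 𝒢.Word x y, k.IsTreeWord T ∧ k.act c = (q.act c).symm.trans (p.act c) := by
    obtain ⟨q', hq', h1⟩ := hq.exists_symm_trans (Word.isTreeWord_nil y)
    obtain ⟨k, hk, h2⟩ := hp.exists_trans hq'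
    refine ⟨k, hk, ?_⟩
    rw [h2, h1, Word.act, State.vertEquiv_id, Equiv.refl_trans]
  obtain ⟨k, hk, hk'⟩ := key
  have h1 : (((q.act c).trans f).trans (p.act c).symm = Equiv.refl _) ↔ f = k.act c := by
    rw [hk']
    constructor
    · intro H
      refine Equiv.ext fun s => ?_
      have := congrArg (p.act c) (Equiv.congr_fun H ((q.act c).symm s))
      simpa using this
    · rintro rfl
      refine Equiv.ext fun s => ?_
      simp
  refine h1.trans ⟨fun H => ⟨k, hk, H⟩, ?_⟩
  rintro ⟨k', hk'', rfl⟩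
  rw [hk''.eq hk]

theorem genFunctor_eq_of_piRel (c : 𝒢.Y) {a b : 𝒢.GenGroupoid T} {f g : a ⟶ b}
    (h : 𝒢.PiRel T f g) : (𝒢.genFunctor T c).map f = (𝒢.genFunctor T c).map g := by
  cases h with
  | free h => exact genFunctor_eq_of_freeRel 𝒢 T c h
  | tree e he h =>
    rw [genFunctor_edgeGen, eqToHom_map]
    refine (conj_eq_eqToHom_iff 𝒢 T c (h.tau_eq he) _ _).2 ?_
    -- A tree edge prefixed to the trivial word is itself a tree word.
    obtain ⟨q, hq, hq'⟩ := (Word.isTreeWord_nil (T := T) _).exists_cons he h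
    refine ⟨q, hq, ?_⟩
    rw [hq', Word.act, State.vertEquiv_id]
    rfl

/-- The action of the fundamental groupoid on the states. -/
noncomputable def piFunctor (c : 𝒢.Y) : 𝒢.Pi1 T ⥤ TypeGpd.{max uV uE uG vG} :=
  CategoryTheory.Quotient.lift _ (𝒢.genFunctor T c)
    fun _ _ _ _ h => genFunctor_eq_of_piRel 𝒢 T c h

/-! ### Reduced words representing units of the fundamental groupoid -/

variable {𝒢 T}

namespace Word

variable {x z : 𝒢.Y}

/-- A word without pinches that represents a unit of the fundamental groupoid has the sequence of
edges of a word along a path in the tree. -/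
theorem exists_isTreeWord_of_isUnitArrow (p : 𝒢.Word x z) (hp : p.NoPinch)
    (h : IsUnitArrow (p.toPi1 T)) :
    ∃ (q : 𝒢.Word x z) (hq : q.IsTreeWord T), State.mk p hp = State.mk q hq.noPinch := by
  have ht : 𝒢.tau T x = 𝒢.tau T z := by
    obtain ⟨h, -⟩ := h
    exact congrArg (fun a : 𝒢.Pi1 T => a.as.as) h
  obtain ⟨h1, h2⟩ := h.map (𝒢.piFunctor T z)
  have h3 : 𝒢.conj T z (p.act z) = eqToHom h1 := (genFunctor_eval 𝒢 T z p).symm.trans h2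
  obtain ⟨q, hq, h4⟩ := (conj_eq_eqToHom_iff 𝒢 T z ht _ _).1 h3
  refine ⟨q, hq, ?_⟩
  -- Both actions are evaluated at the trivial word.
  rw [← act_apply_nil_id p hp, h4, act_apply_nil_id]

/-- The edge sequence is a class invariant, so `p` inherits that of a tree word. In length 0 the
tree word is trivial and `mk_nil_injective` makes `p` a unit, contrary to reducedness. -/
theorem tree_of_isUnitArrow_toPi1 (p : 𝒢.Word x z) (hp : p.SerreReduced)
    (h : IsUnitArrow (p.toPi1 T)) :
    p.edges ≠ [] ∧ Γ.IsReduced p.edges ∧ ∀ e ∈ p.edges, e ∈ T.edges := by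
  cases p with
  | nil g =>
    obtain ⟨q, hq, hs⟩ := exists_isTreeWord_of_isUnitArrow (nil g) trivial h
    have he : [] = q.edges := congrArg State.edges hs
    exfalso
    have hq' := hq.isTransport
    cases hq' with
    | nil => exact hp ⟨rfl, State.mk_nil_injective hs⟩
    | cons => simp [edges] at he
  | cons g e h' p =>
    obtain ⟨q, hq, h⟩ := exists_isTreeWord_of_isUnitArrow (cons g e h' p) hp h
    have he : (cons g e h' p).edges = q.edges := congrArg State.edges h
    exact ⟨nofun, he ▸ hq.2, he ▸ hq.3⟩

/-- In a tree, the only closed path without backtracking is the empty one. -/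
theorem fst_ne_of_isUnitArrow_toPi1 (p : 𝒢.Word x z) (hp : p.SerreReduced)
    (h : IsUnitArrow (p.toPi1 T)) : x.1 ≠ z.1 := by
  intro hxz
  obtain ⟨h1, h2, h3⟩ := p.tree_of_isUnitArrow_toPi1 hp h
  have hpath := p.isPath_edges
  rw [← hxz] at hpath
  have hv := T.mem_verts 𝒢.connected x.1
  exact h1 ((T.maximal.1 _ hv _ hv).unique ⟨hpath, h2, h3⟩ ⟨rfl, .nil, by simp⟩)

end Word

/-! ### Words representing units of the free groupoid are closed -/

variable (𝒢 T)

/-- The functor from the free groupoid to the fundamental groupoid. -/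
def freeToPi : 𝒢.FreeGpd T ⥤ 𝒢.Pi1 T :=
  CategoryTheory.Quotient.lift _ (CategoryTheory.Quotient.functor (𝒢.PiRel T))
    fun _ _ _ _ h => CategoryTheory.Quotient.sound _ (.free h)

/-- The quotient of two vertices in the free group on the vertices. -/
def vertexDiff (v w : V) : SingleObj.star (FreeGroup V) ⟶ SingleObj.star (FreeGroup V) :=
  (FreeGroup.of w * (FreeGroup.of v)⁻¹ : FreeGroup V)

theorem vertexDiff_comp (u v w : V) : vertexDiff u v ≫ vertexDiff v w = vertexDiff u w :=
  show (FreeGroup.of w * (FreeGroup.of v)⁻¹) * (FreeGroup.of v * (FreeGroup.of u)⁻¹) =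
    FreeGroup.of w * (FreeGroup.of u)⁻¹ by group

theorem vertexDiff_self (v : V) : vertexDiff v v = 𝟙 _ :=
  mul_inv_cancel (FreeGroup.of v)

/-- The functor from the generators to the free group on the vertices, which sends a generator
to the quotient of the vertices at its ends. -/
def genVertex : 𝒢.UnitSpace T ⥤q SingleObj (FreeGroup V) where
  obj _ := SingleObj.star _
  map {_ _} f := match f with
    | .vert (x := x) (y := y) _ => vertexDiff x.1 y.1
    | .edge (y := y) (x := x) _ _ => vertexDiff y.1 x.1

/-- The extension of `genVertex` to the free groupoid on the generators. -/
noncomputable def genVertexFunctor : 𝒢.GenGroupoid T ⥤ SingleObj (FreeGroup V) :=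
  Quiver.FreeGroupoid.lift (𝒢.genVertex T)

theorem genVertexFunctor_vertGen {x y : 𝒢.Y} (g : x ⟶ y) :
    (𝒢.genVertexFunctor T).map (𝒢.vertGen T g) = vertexDiff x.1 y.1 :=
  Quiver.FreeGroupoid.lift_map_of _ _

theorem genVertexFunctor_edgeGen (e : E) {y x : 𝒢.Y} (h : 𝒢.EdgeRel e y x) :
    (𝒢.genVertexFunctor T).map (𝒢.edgeGen T e h) = vertexDiff y.1 x.1 :=
  Quiver.FreeGroupoid.lift_map_of _ _

/-- The vertex quotients telescope, so only the end vertices of the word are seen. -/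
theorem genVertexFunctor_eval {x z : 𝒢.Y} (p : 𝒢.Word x z) :
    (𝒢.genVertexFunctor T).map (p.eval T) = vertexDiff x.1 z.1 := by
  induction p with
  | nil g => exact genVertexFunctor_vertGen 𝒢 T g
  | cons g e h p ih =>
    rw [Word.eval, Functor.map_comp, Functor.map_comp, genVertexFunctor_vertGen,
      genVertexFunctor_edgeGen, ih]
    erw [vertexDiff_comp, vertexDiff_comp]

/-- The induced functor on the free groupoid. -/
noncomputable def freeVertexFunctor : 𝒢.FreeGpd T ⥤ SingleObj (FreeGroup V) :=
  CategoryTheory.Quotient.lift _ (𝒢.genVertexFunctor T) fun _ _ _ _ h => by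
    cases h with
    | vert_id x =>
      rw [genVertexFunctor_vertGen, CategoryTheory.Functor.map_id]
      exact vertexDiff_self _
    | vert_comp g h =>
      rw [Functor.map_comp, genVertexFunctor_vertGen, genVertexFunctor_vertGen,
        genVertexFunctor_vertGen]
      exact (vertexDiff_comp _ _ _).symm
    | edge_inv e h =>
      rw [Functor.map_comp, genVertexFunctor_edgeGen, genVertexFunctor_edgeGen,
        CategoryTheory.Functor.map_id]
      exact (vertexDiff_comp _ _ _).trans (vertexDiff_self _)
    | edge_conj u e h h' k =>
      rw [Functor.map_comp, Functor.map_comp, genVertexFunctor_edgeGen, genVertexFunctor_edgeGen,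
        genVertexFunctor_vertGen, genVertexFunctor_vertGen]
      erw [vertexDiff_comp, vertexDiff_comp]

variable {𝒢 T}

theorem Word.fst_eq_of_isUnitArrow_toFree {x z : 𝒢.Y} (p : 𝒢.Word x z)
    (h : IsUnitArrow (p.toFree T)) : x.1 = z.1 := by
  obtain ⟨h1, h2⟩ := h.map (𝒢.freeVertexFunctor T)
  have h3 : FreeGroup.of z.1 * (FreeGroup.of x.1)⁻¹ = 1 :=
    (genVertexFunctor_eval 𝒢 T p).symm.trans h2
  exact (FreeGroup.of_injective (mul_inv_eq_one.1 h3)).symm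

end GraphOfGroupoids

/-- A word is closed iff `x.1 = z.1`, which is automatic for `n = 0`; hence the second assertion
contains the bound `n ≥ 1` of the third. -/
theorem lemma7p8 {V : Type uV} {E : Type uE} {Γ : SerreGraph V E}
    (𝒢 : GraphOfGroupoids.{uV, uE, uG, vG, uH, vH} Γ) (T : Γ.RootedMaximalSubtree)
    {x z : 𝒢.Y} (p : 𝒢.Word x z) (hp : p.SerreReduced) :
    ¬ IsUnitArrow (p.toFree T) ∧
      (x.1 = z.1 → ¬ IsUnitArrow (p.toPi1 T)) ∧
      (¬ (Γ.IsReduced p.edges ∧ ∀ e ∈ p.edges, e ∈ T.edges) → ¬ IsUnitArrow (p.toPi1 T)) :=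
  ⟨fun h => p.fst_ne_of_isUnitArrow_toPi1 hp (h.map (𝒢.freeToPi T))
      (p.fst_eq_of_isUnitArrow_toFree h),
    fun hxz h => p.fst_ne_of_isUnitArrow_toPi1 hp h hxz,
    fun hn h => hn (p.tree_of_isUnitArrow_toPi1 hp h).2⟩
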